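/- Let $m\ge 2$. There is a function $\delta':\mathbb R\to\mathbb R$, depending only on $m$, with $\delta'(\delta)\to 0$ as $\delta\to 0^+$, such that the following holds. Let $k\ge 1$, let $\sigma_1,\dots,\sigma_k$ be permutations of $\{1,\dots,m\}$ and let $\epsilon_{ij}\in\{-1,0,1\}$ for $1\le i\le k$, $1\le j\le m$. Consider the system of equations $$x_{\sigma_i(1)}^{\epsilon_{i\sigma_i(1)}}\,x_{\sigma_i(2)}^{\epsilon_{i\sigma_i(2)}}\cdots x_{\sigma_i(m)}^{\epsilon_{i\sigma_i(m)}}=1\qquad(1\le i\le k),\tag{$*$}$$ and suppose that it is strongly graph-representable, that is: there are a finite directed graph $H$ (loops and multiple arcs are allowed) with exactly $m$ arcs, coloured bijectively by $1,\dots,m$, and a spanning tree $T$ of $H$ such that there is a bijection from the equations of $(*)$ to the arcs of $H$ outside $T$ under which, for each $i$, the following sequence of arc traversals runs exactly once around the fundamental cycle, with respect to $T$, of the arc assigned to the $i$-th equation (starting at any of its vertices, in either direction): for $j=1,\dots,m$ in this order, traverse the arc coloured $\sigma_i(j)$ in its direction if $\epsilon_{i\sigma_i(j)}=1$, traverse it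 against its direction if $\epsilon_{i\sigma_i(j)}=-1$, and skip it if $\epsilon_{i\sigma_i(j)}=0$. (Then $k\le m$.) Let $G$ be any finite group, of order $N$, let $A_1,\dots,A_m\subseteq G$, and let $\delta>0$. If $(*)$ has fewer than $\delta N^{m-k}$ solutions with $x_i\in A_i$ for all $i$, then there are subsets $A_i'\subseteq A_i$ with $|A_i\setminus A_i'|\le\delta'(\delta)\,N$ for all $i$ such that $(*)$ has no solution with $x_i\in A_i'$ for all $i$. -/

import Mathlib

open Filter Topology

/-- A finite system of `k` word equations in the `m` variables `x₀, …, x₍ₘ₋₁₎`.  The `i`-th equation is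
`x_{σᵢ(0)} ^ ε_{i,σᵢ(0)} ⋯ x_{σᵢ(m-1)} ^ ε_{i,σᵢ(m-1)} = 1`, all exponents being `-1`, `0` or `1`. -/
structure WordSystem (k m : ℕ) where
  /-- the order in which the variables occur in each equation -/
  perm : Fin k → Equiv.Perm (Fin m)
  /-- `exponent i v` is the exponent of the variable `v` in equation `i` -/
  exponent : Fin k → Fin m → SignType

/-- A directed graph on `V` with `m` arcs, which are coloured (identified) by `Fin m`.
Parallel arcs, antiparallel arcs and loops are allowed. -/
structure ColoredDigraph (V : Type) (m : ℕ) where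
  /-- the initial vertex of the arc of a given colour -/
  src : Fin m → V
  /-- the terminal vertex of the arc of a given colour -/
  tgt : Fin m → V

namespace ColoredDigraph

variable {V : Type} {m : ℕ}

/-- The vertex at which a traversal of an arc starts. A traversal is an arc with a direction:
`true` for its own direction, `false` for the opposite one. -/
def start (H : ColoredDigraph V m) (s : Fin m × Bool) : V :=
  if s.2 then H.src s.1 else H.tgt s.1

/-- The vertex at which a traversal of an arc ends. -/
def finish (H : ColoredDigraph V m) (s : Fin m × Bool) : V :=
  if s.2 then H.tgt s.1 else H.src s.1

/-- The list `l` of traversals, in this order, is a walk from `u` to `v` (arcs may be traversed in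
either direction). -/
def IsWalk (H : ColoredDigraph V m) : V → List (Fin m × Bool) → V → Prop
  | u, [], v => u = v
  | u, s :: l, v => H.start s = u ∧ H.IsWalk (H.finish s) l v

/-- The list `l` of traversals, in this order, is a cycle of (the underlying undirected multigraph
of) `H`: a nonempty closed walk that repeats neither an arc nor a vertex. -/
def IsCycle (H : ColoredDigraph V m) (l : List (Fin m × Bool)) : Prop :=
  l ≠ [] ∧ (∃ u, H.IsWalk u l u) ∧ (l.map Prod.fst).Nodup ∧ (l.map H.start).Nodup

/-- The arcs in `T`, together with all vertices of `H`, form a tree: connected and acyclic. -/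
def IsSpanningTree (H : ColoredDigraph V m) (T : Set (Fin m)) : Prop :=
  Nonempty V ∧
  (∀ u v, ∃ l, H.IsWalk u l v ∧ ∀ s ∈ l, s.1 ∈ T) ∧
  ¬ ∃ l, H.IsCycle l ∧ ∀ s ∈ l, s.1 ∈ T

/-- The list `l` traverses the fundamental cycle, with respect to the spanning tree `T`, of the
arc `e` outside `T`: the cycle that contains `e` and otherwise only arcs of `T`.
The starting point and the direction of the traversal are arbitrary. -/
def IsFundamentalCycle (H : ColoredDigraph V m) (T : Set (Fin m)) (e : Fin m)
    (l : List (Fin m × Bool)) : Prop :=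
  H.IsCycle l ∧ e ∉ T ∧ e ∈ l.map Prod.fst ∧ ∀ s ∈ l, s.1 = e ∨ s.1 ∈ T

end ColoredDigraph

namespace WordSystem

variable {k m : ℕ}

/-- `x` satisfies all equations of the system (products in the given order). -/
def IsSolution (S : WordSystem k m) {G : Type*} [Group G] (x : Fin m → G) : Prop :=
  ∀ i, (List.ofFn fun j => x (S.perm i j) ^ (S.exponent i (S.perm i j) : ℤ)).prod = 1

/-- The solutions of the system with `x i ∈ A i` for all `i`. -/
def solutions (S : WordSystem k m) {G : Type*} [Group G] (A : Fin m → Set G) : Set (Fin m → G) :=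
  {x | (∀ i, x i ∈ A i) ∧ S.IsSolution x}

/-- The traversal prescribed by a variable with a given exponent: the arc of that colour in its
direction for `1`, in the opposite direction for `-1`, and nothing for `0`. -/
def traversal (v : Fin m) : SignType → Option (Fin m × Bool)
  | .pos => some (v, true)
  | .neg => some (v, false)
  | .zero => none

/-- The traversals prescribed by the `i`-th equation, in order, empty ones omitted. -/
def traversals (S : WordSystem k m) (i : Fin k) : List (Fin m × Bool) :=
  (List.ofFn (S.perm i)).filterMap fun v => traversal v (S.exponent i v)

/-- The system is strongly graph-representable: for some finite directed graph with `m` arcs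
coloured by the variables and some spanning tree `T` of it, the equations traverse precisely the
fundamental cycles with respect to `T`, one equation for each arc outside `T`. -/
def StronglyGraphRepresentable (S : WordSystem k m) : Prop :=
  ∃ (V : Type) (_ : Finite V) (H : ColoredDigraph V m) (T : Set (Fin m)), H.IsSpanningTree T ∧
    ∃ e : Fin k ≃ {a : Fin m // a ∉ T}, ∀ i, H.IsFundamentalCycle T (e i) (S.traversals i)

/-- The exponent `m - k` is never truncated for a representable system. -/
theorem StronglyGraphRepresentable.le {S : WordSystem k m} (h : S.StronglyGraphRepresentable) :
    k ≤ m := by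
  obtain ⟨V, _, H, T, _, e, _⟩ := h
  simpa using Fintype.card_le_of_injective (fun i => (e i : Fin m))
    (Subtype.val_injective.comp e.injective)

end WordSystem

/-!
Fix a representation of the system by a graph `H` with spanning tree `T`. A function `g` on the
vertices with values in `G` (a potential) labels each arc by the quotient `(g src)⁻¹ * g tgt`. The
equations of the fundamental cycles say precisely that a labelling comes from a potential
(`WordSystem.isSolution_iff_exists_coboundary`), and a potential is determined by its value at one
vertex and its labels on `T` (`ColoredDigraph.IsSpanningTree.bijective`). In particular `H` has
`m - k + 1` vertices, and a system with fewer than `δ * N ^ (m - k)` solutions in the sets `A i` has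
fewer than `δ * N ^ |V|` potentials whose labels lie in the `A i`. These potentials are the
homomorphisms from `H` to the graph in which arcs of colour `i` join `a` to `b` if `a⁻¹ * b ∈ A i`.

By the removal lemma for homomorphisms from `H` (`ColoredDigraph.removal`), they can all be
destroyed by deleting at most `(ε / m) * N ^ 2` arcs of each colour. From `A i` one removes the
elements `a` for which at least `N / m` of the `N` arcs joining `c` to `c * a` were deleted; there
are at most `ε * N` of these. A solution in the remaining sets would come from a potential `g`,
and fewer than `N` of the `N` translates `c * g` would meet a deleted arc
(`ColoredDigraph.exists_translate_notMem`), although every translate has to.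

The removal lemma itself is deduced from Mathlib's Szemerédi regularity lemma, applied to a graph on
`Fin n × G` that encodes all relations. The parts of the regular partition need not respect the
product structure, so besides the edges inside parts and between irregular or sparse pairs of
parts one also deletes those at vertices whose first coordinate is rare within their part
(`exists_equipartition_forall_adj`). A surviving tuple then yields large, pairwise lower regular
subsets of `G`, and the counting lemma (`pow_le_card_of_isLowerRegular`) finds many tuples there.
-/

/-! ### Lower regular pairs and the counting lemma -/

open scoped Classical in
/-- The relation `r` is lower regular between `X` and `Y`: any subsets `A ⊆ X` and `B ⊆ Y` with at
least `s` elements each span at least `d * |A| * |B|` related pairs. The threshold `s` is absolute,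
so that the property passes to subsets of `X` and `Y` unchanged. -/
def IsLowerRegular {α β : Type*} (d s : ℝ) (r : α → β → Prop) (X : Finset α) (Y : Finset β) :
    Prop :=
  ∀ A ⊆ X, ∀ B ⊆ Y, s ≤ A.card → s ≤ B.card →
    d * A.card * B.card ≤ ((A ×ˢ B).filter fun p => r p.1 p.2).card

theorem IsLowerRegular.mono {α β : Type*} {d s : ℝ} {r : α → β → Prop} {X X' : Finset α}
    {Y Y' : Finset β} (h : IsLowerRegular d s r X Y) (hX : X' ⊆ X) (hY : Y' ⊆ Y) :
    IsLowerRegular d s r X' Y' :=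
  fun A hA B hB => h A (hA.trans hX) B (hB.trans hY)

theorem IsLowerRegular.of_forall {α β : Type*} {d s : ℝ} {r : α → β → Prop} (hd : d ≤ 1)
    (hr : ∀ a b, r a b) (X : Finset α) (Y : Finset β) : IsLowerRegular d s r X Y := by
  intro A _ B _ _ _
  simp only [hr, Finset.filter_true, Finset.card_product, Nat.cast_mul]
  rw [mul_assoc]
  exact mul_le_of_le_one_left (by positivity) hd

open scoped Classical in
/-- Fewer than `s` elements of `X` have an unusually small neighbourhood in `Y`: the set of all of
them spans too few related pairs with `Y`. -/
theorem IsLowerRegular.card_low_degree_lt {α β : Type*} {d s : ℝ} {r : α → β → Prop}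
    {X : Finset α} {Y : Finset β} (h : IsLowerRegular d s r X Y) (hs : 0 < s)
    (hY : s ≤ Y.card) :
    ((X.filter fun x => ((Y.filter fun y => r x y).card : ℝ) < d * Y.card).card : ℝ) < s := by
  by_contra! hcon
  set B := X.filter fun x => ((Y.filter fun y => r x y).card : ℝ) < d * Y.card with hB
  have h1 := h B (Finset.filter_subset _ _) Y subset_rfl hcon hY
  have h2 : (((B ×ˢ Y).filter fun p => r p.1 p.2).card : ℝ)
      = ∑ x ∈ B, ((Y.filter fun y => r x y).card : ℝ) := by
    simp only [Finset.card_filter, Finset.sum_product]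
    push_cast
    rfl
  have hne : B.Nonempty := by
    rw [← Finset.card_pos]
    exact_mod_cast hs.trans_le hcon
  have h3 : ∑ x ∈ B, ((Y.filter fun y => r x y).card : ℝ) < ∑ _x ∈ B, d * (Y.card : ℝ) :=
    Finset.sum_lt_sum_of_nonempty hne fun x hx => (Finset.mem_filter.1 hx).2
  rw [Finset.sum_const, nsmul_eq_mul] at h3
  rw [h2] at h1
  nlinarith

open scoped Classical in
/-- The counting lemma: between sets that are large compared to `s` and pairwise lower regular there
are at least `s ^ n` tuples satisfying all relations. The first entry is chosen among the at least
`s` elements with large neighbourhoods in all other sets, and these neighbourhoods replace the other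
sets, which costs a factor `d` in size. -/
theorem pow_le_card_of_isLowerRegular {α : Type*} {d s : ℝ} (hd₀ : 0 < d) (hd₁ : d ≤ 1)
    (hs : 0 < s) (n : ℕ) (X : Fin n → Finset α) (E : Fin n → Fin n → α → α → Prop)
    (hE : ∀ u v, u < v → IsLowerRegular d s (E u v) (X u) (X v))
    (hX : ∀ v, n * s ≤ d ^ n * (X v).card) :
    s ^ n ≤ ((Fintype.piFinset X).filter fun g => ∀ u v, u < v → E u v (g u) (g v)).card := by
  induction n with
  | zero => simp
  | succ n ih =>
    have hX' : ∀ v, (n + 1) * s ≤ (X v).card := fun v => by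
      have := hX v
      push_cast at this
      exact this.trans (mul_le_of_le_one_left (by positivity) (pow_le_one₀ hd₀.le hd₁))
    have hsX : ∀ v, s ≤ (X v).card := fun v =>
      le_trans (by nlinarith [(Nat.cast_nonneg n : (0 : ℝ) ≤ n)]) (hX' v)
    let Y : α → Fin n → Finset α := fun x v => (X v.succ).filter fun y => E 0 v.succ x y
    let low : Fin n → Finset α := fun v =>
      (X 0).filter fun x => ((Y x v).card : ℝ) < d * (X v.succ).card
    let good : Finset α := (X 0) \ Finset.univ.biUnion low
    have hlow : ∀ v, ((low v).card : ℝ) ≤ s := fun v =>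
      ((hE 0 v.succ (Fin.succ_pos v)).card_low_degree_lt hs (hsX _)).le
    have hgood : s ≤ good.card := by
      have h1 : (X 0).card ≤ good.card + (Finset.univ.biUnion low).card := by
        have := Finset.le_card_sdiff (Finset.univ.biUnion low) (X 0)
        simp only [good]
        omega
      have h2 : ((Finset.univ.biUnion low).card : ℝ) ≤ n * s := by
        calc ((Finset.univ.biUnion low).card : ℝ) ≤ ∑ v, ((low v).card : ℝ) := by
              exact_mod_cast Finset.card_biUnion_le
          _ ≤ ∑ _v : Fin n, s := Finset.sum_le_sum fun v _ => hlow v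
          _ = n * s := by simp
      have h3 : ((X 0).card : ℝ) ≤ good.card + (Finset.univ.biUnion low).card := by
        exact_mod_cast h1
      linarith [hX' 0]
    let F : α → Finset (Fin n → α) := fun x =>
      (Fintype.piFinset (Y x)).filter fun g => ∀ u v, u < v → E u.succ v.succ (g u) (g v)
    have hF : ∀ x ∈ good, s ^ n ≤ (F x).card := by
      intro x hx
      apply ih
      · intro u v huv
        exact (hE u.succ v.succ (by simpa using huv)).mono (Finset.filter_subset _ _)
          (Finset.filter_subset _ _)
      · intro v
        have hx2 : d * (X v.succ).card ≤ (Y x v).card := by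
          by_contra! hcon
          simp only [good, Finset.mem_sdiff, Finset.mem_biUnion, Finset.mem_univ, true_and,
            not_exists] at hx
          exact hx.2 v (Finset.mem_filter.2 ⟨hx.1, hcon⟩)
        have h4 := hX v.succ
        push_cast at h4
        calc (n : ℝ) * s ≤ (n + 1) * s := by nlinarith
          _ ≤ d ^ (n + 1) * (X v.succ).card := h4
          _ = d ^ n * (d * (X v.succ).card) := by ring
          _ ≤ d ^ n * (Y x v).card := by gcongr
    have hcard : (good.sigma F).card ≤
        ((Fintype.piFinset X).filter fun g => ∀ u v, u < v → E u v (g u) (g v)).card := by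
      apply Finset.card_le_card_of_injOn
        (fun p : (_ : α) × (Fin n → α) => (Fin.cons p.1 p.2 : Fin (n + 1) → α))
      · rintro ⟨x, g⟩ hp
        simp only [Finset.coe_sigma, Set.mem_sigma_iff, Finset.mem_coe] at hp
        obtain ⟨hx, hg⟩ := hp
        obtain ⟨hg1, hg2⟩ := Finset.mem_filter.1 hg
        rw [Fintype.mem_piFinset] at hg1
        rw [Finset.mem_coe, Finset.mem_filter, Fintype.mem_piFinset]
        refine ⟨Fin.cases (Finset.mem_sdiff.1 hx).1
          fun v => (Finset.mem_filter.1 (hg1 v)).1, ?_⟩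
        intro u v huv
        induction v using Fin.cases with
        | zero => exact absurd huv (Fin.not_lt_zero _)
        | succ v =>
          induction u using Fin.cases with
          | zero => exact (Finset.mem_filter.1 (hg1 v)).2
          | succ u => exact hg2 u v (by simpa using huv)
      · rintro ⟨x, g⟩ _ ⟨x', g'⟩ _ heq
        obtain ⟨rfl, rfl⟩ := Fin.cons_inj.1 heq
        rfl
    calc s ^ (n + 1) = s * s ^ n := by ring
      _ ≤ good.card * s ^ n := by gcongr
      _ = ∑ _x ∈ good, s ^ n := by simp
      _ ≤ ∑ x ∈ good, ((F x).card : ℝ) := Finset.sum_le_sum hF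
      _ = (good.sigma F).card := by rw [Finset.card_sigma]; push_cast; rfl
      _ ≤ _ := by exact_mod_cast hcard

/-! ### Cleaning up a regular partition -/

open SzemerediRegularity in
/-- Szemerédi's regularity lemma in the form used for removal, for a graph whose vertices are
coloured by `κ`. All but at most `e * |α| ^ 2` edges run between parts that form a uniform pair of
density at least `d`, and have ends whose colours are not rare within their parts. -/
theorem exists_equipartition_forall_adj {α : Type*} [Fintype α] [DecidableEq α] [Nonempty α]
    (Γ : SimpleGraph α) [DecidableRel Γ.Adj] {n : ℕ} (κ : α → Fin n) {e ρ d η : ℝ} {l : ℕ}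
    (he : 0 < e) (hρ : 0 < ρ) (hd : 0 ≤ d) (hη : 0 ≤ η) (hρe : 16 * ρ ≤ e)
    (hde : 16 * d ≤ e) (hηe : 8 * (n * η) ≤ e) (hle : 8 / e ≤ l)
    (hl : l ≤ Fintype.card α) :
    ∃ P : Finpartition (Finset.univ : Finset α), P.IsEquipartition ∧ P.parts.card ≤ bound ρ l ∧
      ∃ bad : Finset (α × α), (bad.card : ℝ) ≤ e * (Fintype.card α : ℝ) ^ 2 ∧
        ∀ a b, Γ.Adj a b → (a, b) ∉ bad → ∃ U ∈ P.parts, ∃ V ∈ P.parts, a ∈ U ∧ b ∈ V ∧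
          Γ.IsUniform ρ U V ∧ d ≤ Γ.edgeDensity U V ∧
          η * U.card ≤ (U.filter fun x => κ x = κ a).card ∧
          η * V.card ≤ (V.filter fun x => κ x = κ b).card := by
  obtain ⟨P, hP, hlP, hPb, hPu⟩ := szemeredi_regularity Γ hρ hl
  refine ⟨P, hP, hPb, ?_⟩
  -- vertices whose colour is rare within their part
  let W : Finset α := P.parts.biUnion fun U => Finset.univ.biUnion fun i : Fin n =>
    if ((U.filter fun x => κ x = i).card : ℝ) < η * U.card then U.filter fun x => κ x = i else ∅
  have hW : (W.card : ℝ) ≤ n * η * Fintype.card α := by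
    calc (W.card : ℝ) ≤ ∑ U ∈ P.parts, ∑ _i : Fin n, η * (U.card : ℝ) := by
          refine (Nat.cast_le.2 Finset.card_biUnion_le).trans ?_
          push_cast
          refine Finset.sum_le_sum fun U _ => ?_
          refine (Nat.cast_le.2 Finset.card_biUnion_le).trans ?_
          push_cast
          refine Finset.sum_le_sum fun i _ => ?_
          split_ifs with h
          · exact h.le
          · simpa using by positivity
      _ = n * η * ((∑ U ∈ P.parts, U.card : ℕ) : ℝ) := by
          simp only [Finset.sum_const, Finset.card_univ, Fintype.card_fin, nsmul_eq_mul]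
          push_cast
          rw [Finset.mul_sum]
          exact Finset.sum_congr rfl fun _ _ => by ring
      _ = n * η * Fintype.card α := by rw [P.sum_card_parts, Finset.card_univ]
  let irregular := (P.nonUniforms Γ ρ).biUnion fun (U, V) => U ×ˢ V
  let inner := P.parts.biUnion Finset.offDiag
  let sparse := (P.sparsePairs Γ d).biUnion fun (U, V) => Γ.interedges U V
  let rare := W ×ˢ (Finset.univ : Finset α) ∪ (Finset.univ : Finset α) ×ˢ W
  have h1 : (irregular.card : ℝ) ≤ 4 * ρ * (Fintype.card α : ℝ) ^ 2 := by
    simpa only [Finset.card_univ] using (hP.sum_nonUniforms_lt Finset.univ_nonempty hρ hPu).le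
  have h2 : (inner.card : ℝ) ≤ e / 2 / 2 * (Fintype.card α : ℝ) ^ 2 := by
    have : (4 : ℝ) / (e / 2) ≤ P.parts.card := by
      have h : (4 : ℝ) / (e / 2) = 8 / e := by field_simp; norm_num
      rw [h]
      exact hle.trans (by exact_mod_cast hlP)
    simpa only [Finset.card_univ] using hP.card_biUnion_offDiag_le (half_pos he) this
  have h3 : (sparse.card : ℝ) ≤ 4 * d * (Fintype.card α : ℝ) ^ 2 := by
    simpa only [Finset.card_univ] using hP.card_interedges_sparsePairs_le (G := Γ) hd
  have h4 : (rare.card : ℝ) ≤ 2 * (n * η) * (Fintype.card α : ℝ) ^ 2 := by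
    have : (rare.card : ℝ) ≤ W.card * Fintype.card α + Fintype.card α * W.card := by
      have h := Finset.card_union_le (W ×ˢ (Finset.univ : Finset α))
        ((Finset.univ : Finset α) ×ˢ W)
      rw [Finset.card_product, Finset.card_product, Finset.card_univ] at h
      exact_mod_cast h
    nlinarith [(Nat.cast_nonneg (Fintype.card α) : (0 : ℝ) ≤ Fintype.card α)]
  refine ⟨irregular ∪ inner ∪ sparse ∪ rare, ?_, ?_⟩
  · have h5 : (((irregular ∪ inner ∪ sparse ∪ rare).card : ℕ) : ℝ)
        ≤ irregular.card + inner.card + sparse.card + rare.card := by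
      have ha := Finset.card_union_le (irregular ∪ inner ∪ sparse) rare
      have hb := Finset.card_union_le (irregular ∪ inner) sparse
      have hc := Finset.card_union_le irregular inner
      exact_mod_cast (by omega : _ ≤ irregular.card + inner.card + sparse.card + rare.card)
    nlinarith [sq_nonneg (Fintype.card α : ℝ)]
  · intro a b hab hbad
    simp only [Finset.mem_union, not_or] at hbad
    obtain ⟨⟨⟨hirr, hinn⟩, hspa⟩, hrare⟩ := hbad
    have haU : a ∈ P.part a := P.mem_part (Finset.mem_univ a)
    have hbV : b ∈ P.part b := P.mem_part (Finset.mem_univ b)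
    have hU : P.part a ∈ P.parts := P.part_mem.2 (Finset.mem_univ a)
    have hV : P.part b ∈ P.parts := P.part_mem.2 (Finset.mem_univ b)
    have hUV : P.part a ≠ P.part b := by
      intro h
      apply hinn
      refine Finset.mem_biUnion.2 ⟨_, hU, Finset.mem_offDiag.2 ⟨haU, h ▸ hbV, hab.ne⟩⟩
    have hlarge : ∀ c, c ∉ W →
        η * (P.part c).card ≤ ((P.part c).filter fun x => κ x = κ c).card := by
      intro c hc
      by_contra! hcon
      apply hc
      refine Finset.mem_biUnion.2 ⟨_, P.part_mem.2 (Finset.mem_univ c),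
        Finset.mem_biUnion.2 ⟨κ c, Finset.mem_univ _, ?_⟩⟩
      rw [if_pos hcon]
      exact Finset.mem_filter.2 ⟨P.mem_part (Finset.mem_univ c), rfl⟩
    refine ⟨P.part a, hU, P.part b, hV, haU, hbV, ?_, ?_, hlarge a ?_, hlarge b ?_⟩
    · by_contra hcon
      exact hirr (Finset.mem_biUnion.2 ⟨(_, _), (P.mk_mem_nonUniforms Γ).2
        ⟨hU, hV, hUV, hcon⟩, Finset.mem_product.2 ⟨haU, hbV⟩⟩)
    · by_contra! hcon
      exact hspa (Finset.mem_biUnion.2 ⟨(_, _), (P.mk_mem_sparsePairs Γ _ _ _).2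
        ⟨hU, hV, hUV, hcon⟩, (Γ.mk_mem_interedges_iff).2 ⟨haU, hbV, hab⟩⟩)
    · exact fun h => hrare (Finset.mem_union_left _ (Finset.mem_product.2 ⟨h, Finset.mem_univ _⟩))
    · exact fun h => hrare (Finset.mem_union_right _ (Finset.mem_product.2 ⟨Finset.mem_univ _, h⟩))

/-- A uniform pair of large density is lower regular between any two of its colour classes. -/
theorem isLowerRegular_of_isUniform {κ β : Type*} {Γ : SimpleGraph (κ × β)}
    [DecidableRel Γ.Adj] {ρ d s : ℝ}
    {U V : Finset (κ × β)} (h : Γ.IsUniform ρ U V) (hd : d + ρ ≤ Γ.edgeDensity U V)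
    (hs : 0 < s) (hU : U.card * ρ ≤ s) (hV : V.card * ρ ≤ s) (u v : κ) {X Y : Finset β}
    (hX : ∀ a ∈ X, (u, a) ∈ U) (hY : ∀ b ∈ Y, (v, b) ∈ V) :
    IsLowerRegular d s (fun a b => Γ.Adj (u, a) (v, b)) X Y := by
  classical
  intro A hA B hB hsA hsB
  have hu : Function.Injective (Prod.mk u : β → κ × β) := Prod.mk_right_injective u
  have hv : Function.Injective (Prod.mk v : β → κ × β) := Prod.mk_right_injective v
  have hA' : (A.image (Prod.mk u)).card = A.card := Finset.card_image_of_injective _ hu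
  have hB' : (B.image (Prod.mk v)).card = B.card := Finset.card_image_of_injective _ hv
  have h1 := h (s' := A.image (Prod.mk u)) (Finset.image_subset_iff.2 fun a ha => hX a (hA ha))
    (t' := B.image (Prod.mk v)) (Finset.image_subset_iff.2 fun b hb => hY b (hB hb))
    (by rw [hA']; exact hU.trans hsA) (by rw [hB']; exact hV.trans hsB)
  have h2 : d ≤ Γ.edgeDensity (A.image (Prod.mk u)) (B.image (Prod.mk v)) := by
    linarith [(abs_lt.1 h1).1]
  rw [SimpleGraph.edgeDensity_def, hA', hB'] at h2
  push_cast at h2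
  have hA0 : (0 : ℝ) < A.card := hs.trans_le hsA
  have hB0 : (0 : ℝ) < B.card := hs.trans_le hsB
  rw [le_div_iff₀ (by positivity), ← mul_assoc] at h2
  refine h2.trans ?_
  have h3 : (Γ.interedges (A.image (Prod.mk u)) (B.image (Prod.mk v))).card ≤
      ((A ×ˢ B).filter fun p => Γ.Adj (u, p.1) (v, p.2)).card := by
    apply Finset.card_le_card_of_surjOn (Prod.map (Prod.mk u) (Prod.mk v))
    rintro ⟨p, q⟩ hpq
    rw [Finset.mem_coe, SimpleGraph.mk_mem_interedges_iff] at hpq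
    obtain ⟨hp, hq, hadj⟩ := hpq
    obtain ⟨a, ha, rfl⟩ := Finset.mem_image.1 hp
    obtain ⟨b, hb, rfl⟩ := Finset.mem_image.1 hq
    exact ⟨(a, b), by simp [ha, hb, hadj], rfl⟩
  exact (Nat.cast_le.2 h3).trans_eq (by congr!)

/-! ### The partite removal lemma -/

open SzemerediRegularity in
open scoped Classical in
/-- The partite graph removal lemma. If few tuples satisfy the relations `E u v` for all `u < v`,
then all such tuples can be destroyed by deleting few pairs from the relations. Pairs are deleted
only where `J u v` holds; the other relations are trivial. -/
theorem partite_removal (n : ℕ) {ε : ℝ} (hε : 0 < ε) :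
    ∃ δ : ℝ, 0 < δ ∧ ∀ (G : Type*) [Finite G] (J : Fin n → Fin n → Prop)
      (E : Fin n → Fin n → G → G → Prop), (∀ u v, u < v → ¬ J u v → ∀ a b, E u v a b) →
      (Nat.card {g : Fin n → G // ∀ u v, u < v → E u v (g u) (g v)} : ℝ)
        < δ * (Nat.card G : ℝ) ^ n →
      ∃ D : Fin n → Fin n → Set (G × G),
        (∀ u v, ((D u v).ncard : ℝ) ≤ ε * (Nat.card G : ℝ) ^ 2) ∧
        ∀ g : Fin n → G, (∀ u v, u < v → E u v (g u) (g v)) →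
          ∃ u v, u < v ∧ J u v ∧ (g u, g v) ∈ D u v := by
  obtain ⟨e, he, he1, heε⟩ : ∃ e : ℝ, 0 < e ∧ e ≤ 1 ∧ e * (n : ℝ) ^ 2 ≤ ε := by
    refine ⟨min 1 (ε / (n + 1 : ℝ) ^ 2), by positivity, min_le_left _ _, ?_⟩
    calc min 1 (ε / (n + 1 : ℝ) ^ 2) * (n : ℝ) ^ 2
        ≤ ε / (n + 1 : ℝ) ^ 2 * (n + 1 : ℝ) ^ 2 := by
          gcongr
          · exact min_le_right _ _
          · linarith
      _ = ε := div_mul_cancel₀ _ (by positivity)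
  set d : ℝ := e / 32 with hd
  have hd0 : 0 < d := by positivity
  obtain ⟨η, hη0, hη⟩ : ∃ η : ℝ, 0 < η ∧ 8 * (n * η) ≤ e := by
    refine ⟨e / (8 * (n + 1)), by positivity, ?_⟩
    rw [show 8 * (n * (e / (8 * (n + 1)))) = e * (n / (n + 1) : ℝ) by field_simp]
    exact mul_le_of_le_one_right he.le ((div_le_one (by positivity)).2 (by linarith))
  obtain ⟨ρ, hρ0, hρe, hρd, hρη, hρn⟩ : ∃ ρ : ℝ, 0 < ρ ∧ 16 * ρ ≤ e ∧ ρ ≤ d ∧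
      2 * n * ρ ≤ η * d ^ n ∧ 2 * n * n * ρ ≤ d ^ n := by
    refine ⟨min (min (e / 16) d) (min (η * d ^ n / (2 * n + 1)) (d ^ n / (2 * n * n + 1))),
      by positivity, ?_, ?_, ?_, ?_⟩
    · linarith [min_le_left (min (e / 16) d)
        (min (η * d ^ n / (2 * n + 1)) (d ^ n / (2 * n * n + 1))), min_le_left (e / 16) d]
    · exact (min_le_left _ _).trans (min_le_right _ _)
    · calc 2 * n * _ ≤ (2 * n + 1) * (η * d ^ n / (2 * n + 1)) := by
            gcongr
            · linarith
            · exact (min_le_right _ _).trans (min_le_left _ _)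
        _ = η * d ^ n := mul_div_cancel₀ _ (by positivity)
    · calc 2 * n * n * _ ≤ (2 * n * n + 1) * (d ^ n / (2 * n * n + 1)) := by
            gcongr
            · linarith
            · exact (min_le_right _ _).trans (min_le_right _ _)
        _ = d ^ n := mul_div_cancel₀ _ (by positivity)
  set l : ℕ := ⌈8 / e⌉₊
  have hl0 : 0 < l := Nat.ceil_pos.2 (by positivity)
  have hB0 : (0 : ℝ) < bound ρ l := by exact_mod_cast bound_pos ρ l
  refine ⟨min (1 / (l : ℝ) ^ n) ((ρ / bound ρ l) ^ n), by positivity, ?_⟩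
  intro G _ J E hJ hcount
  have := Fintype.ofFinite G
  rw [Nat.card_eq_fintype_card (α := G)] at *
  rcases lt_or_ge (n * Fintype.card G) l with hsmall | hlarge
  · -- a set of bounded size admits no such tuple at all
    have h1 : (Fintype.card G : ℝ) ^ n ≤ (l : ℝ) ^ n := by
      rcases Nat.eq_zero_or_pos n with rfl | hn
      · simp
      · have : Fintype.card G ≤ l := (Nat.le_mul_of_pos_left _ hn).trans hsmall.le
        gcongr
    have h2 : (Nat.card {g : Fin n → G // ∀ u v, u < v → E u v (g u) (g v)} : ℝ) < 1 := by
      refine hcount.trans_le ?_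
      calc _ ≤ 1 / (l : ℝ) ^ n * (l : ℝ) ^ n := by
            gcongr
            exact min_le_left _ _
        _ = 1 := by field_simp
    have h3 : Nat.card {g : Fin n → G // ∀ u v, u < v → E u v (g u) (g v)} = 0 := by
      have : Nat.card {g : Fin n → G // ∀ u v, u < v → E u v (g u) (g v)} < 1 := by
        exact_mod_cast h2
      omega
    have h4 := (Finite.card_eq_zero_iff).1 h3
    exact ⟨fun _ _ => ∅, fun _ _ => by simpa using by positivity, fun g hg =>
      (h4.false ⟨g, hg⟩).elim⟩
  have hn : 0 < n := Nat.pos_of_ne_zero (by rintro rfl; omega)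
  have hG : 0 < Fintype.card G := Nat.pos_of_ne_zero (by intro h; rw [h] at hlarge; omega)
  have hcardα : Fintype.card (Fin n × G) = n * Fintype.card G := by simp
  have : Nonempty (Fin n × G) := Fintype.card_pos_iff.1 (by rw [hcardα]; positivity)
  let Γ : SimpleGraph (Fin n × G) :=
    SimpleGraph.fromRel fun p q => p.1 < q.1 ∧ J p.1 q.1 ∧ E p.1 q.1 p.2 q.2
  have hΓ : ∀ u v, u < v → J u v → ∀ a b, Γ.Adj (u, a) (v, b) ↔ E u v a b := by
    intro u v huv hJuv a b
    simp only [Γ, SimpleGraph.fromRel_adj]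
    constructor
    · rintro ⟨_, h | h⟩
      · exact h.2.2
      · exact absurd h.1 huv.asymm
    · exact fun h => ⟨fun h' => huv.ne (congrArg Prod.fst h'), Or.inl ⟨huv, hJuv, h⟩⟩
  obtain ⟨P, hP, hPb, bad, hbad, hgood⟩ := exists_equipartition_forall_adj Γ
    (Prod.fst : Fin n × G → Fin n) (d := 2 * d) he hρ0 (by positivity) hη0.le hρe
    (by rw [hd]; linarith) hη (Nat.le_ceil _) (by rw [hcardα]; exact hlarge)
  refine ⟨fun u v => {p | ((u, p.1), (v, p.2)) ∈ bad}, fun u v => ?_, ?_⟩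
  · have h1 : ({p : G × G | ((u, p.1), (v, p.2)) ∈ bad}).ncard ≤ bad.card := by
      rw [← Set.ncard_coe_finset]
      refine Set.ncard_le_ncard_of_injOn (fun p : G × G => ((u, p.1), (v, p.2)))
        (fun p hp => hp) ?_
      rintro ⟨a, b⟩ _ ⟨a', b'⟩ _ h
      simpa using h
    calc _ ≤ (bad.card : ℝ) := by exact_mod_cast h1
      _ ≤ e * (Fintype.card (Fin n × G) : ℝ) ^ 2 := hbad
      _ = e * (n : ℝ) ^ 2 * (Fintype.card G : ℝ) ^ 2 := by rw [hcardα]; push_cast; ring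
      _ ≤ ε * (Fintype.card G : ℝ) ^ 2 := by gcongr
  -- A surviving tuple points at parts between which the counting lemma finds many tuples.
  intro g hg
  by_contra! hsurv
  set S : ℕ := Fintype.card (Fin n × G) / P.parts.card + 1
  have hparts : 0 < P.parts.card :=
    Finset.card_pos.2 ⟨_, P.part_mem.2 (Finset.mem_univ (Classical.arbitrary _))⟩
  have hSub : ∀ U ∈ P.parts, U.card ≤ S := fun U hU => by
    simpa only [Finset.card_univ] using hP.card_part_le_average_add_one hU
  have hSlb : ∀ U ∈ P.parts, S ≤ 2 * U.card := fun U hU => by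
    have h1 := hP.average_le_card_part hU
    have h2 := (P.nonempty_of_mem_parts hU).card_pos
    rw [Finset.card_univ] at h1
    omega
  have hs0 : 0 < ρ * (S : ℝ) := by positivity
  let touched : Fin n → Prop := fun v => ∃ u, (v < u ∧ J v u) ∨ (u < v ∧ J u v)
  -- At an index without nontrivial relation nothing is known about the part of `(v, g v)`: its
  -- fibre over `v` may be tiny, so all of `G` is used instead.
  let X : Fin n → Finset G := fun v =>
    if touched v then Finset.univ.filter fun a => (v, a) ∈ P.part (v, g v) else Finset.univ
  have hXcard : ∀ v, touched v →
      (((P.part (v, g v)).filter fun x => x.1 = v).card : ℝ) = (X v).card := by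
    intro v hv
    simp only [X, if_pos hv]
    norm_cast
    symm
    refine Finset.card_bij (fun a _ => (v, a)) ?_ ?_ ?_
    · intro a ha
      simpa using ha
    · intro a _ b _ hab
      simpa using hab
    · rintro ⟨u, a⟩ hb
      obtain ⟨h1, h2⟩ := Finset.mem_filter.1 hb
      obtain rfl : u = v := h2
      exact ⟨a, by simpa using h1, rfl⟩
  have hpair : ∀ u v, u < v → J u v →
      Γ.IsUniform ρ (P.part (u, g u)) (P.part (v, g v)) ∧
      2 * d ≤ Γ.edgeDensity (P.part (u, g u)) (P.part (v, g v)) ∧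
      η * (P.part (u, g u)).card ≤ (X u).card ∧ η * (P.part (v, g v)).card ≤ (X v).card := by
    intro u v huv hJuv
    obtain ⟨U, hU, V, hV, hu, hv, h1, h2, h3, h4⟩ :=
      hgood _ _ ((hΓ u v huv hJuv _ _).2 (hg u v huv)) (hsurv u v huv hJuv)
    obtain rfl := P.part_eq_of_mem hU hu
    obtain rfl := P.part_eq_of_mem hV hv
    exact ⟨h1, h2, h3.trans_eq (hXcard u ⟨v, Or.inl ⟨huv, hJuv⟩⟩),
      h4.trans_eq (hXcard v ⟨u, Or.inr ⟨huv, hJuv⟩⟩)⟩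
  have hpart : ∀ v, P.part (v, g v) ∈ P.parts := fun v => P.part_mem.2 (Finset.mem_univ _)
  have hd1 : d ≤ 1 := by rw [hd]; linarith
  have hlower : ∀ u v, u < v → IsLowerRegular d (ρ * S) (E u v) (X u) (X v) := by
    intro u v huv
    by_cases hJuv : J u v
    · obtain ⟨h1, h2, -, -⟩ := hpair u v huv hJuv
      have h3 : E u v = fun a b => Γ.Adj (u, a) (v, b) := by
        ext a b
        exact (hΓ u v huv hJuv a b).symm
      rw [h3]
      refine isLowerRegular_of_isUniform h1 (by linarith) hs0 ?_ ?_ u v ?_ ?_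
      · rw [mul_comm]
        gcongr
        exact hSub _ (hpart u)
      · rw [mul_comm]
        gcongr
        exact hSub _ (hpart v)
      · intro a ha
        have hu : touched u := ⟨v, Or.inl ⟨huv, hJuv⟩⟩
        simpa [X, if_pos hu] using ha
      · intro a ha
        have hv : touched v := ⟨u, Or.inr ⟨huv, hJuv⟩⟩
        simpa [X, if_pos hv] using ha
    · exact IsLowerRegular.of_forall hd1 (hJ u v huv hJuv) _ _
  have hbig : ∀ v, n * (ρ * S) ≤ d ^ n * (X v).card := by
    intro v
    have hSv : (S : ℝ) ≤ 2 * (P.part (v, g v)).card := by exact_mod_cast hSlb _ (hpart v)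
    by_cases hv : touched v
    · have h1 : η * (P.part (v, g v)).card ≤ (X v).card := by
        obtain ⟨u, h | h⟩ := hv
        · exact (hpair v u h.1 h.2).2.2.1
        · exact (hpair u v h.1 h.2).2.2.2
      calc n * (ρ * S) ≤ n * (ρ * (2 * (P.part (v, g v)).card)) := by gcongr
        _ = 2 * n * ρ * (P.part (v, g v)).card := by ring
        _ ≤ η * d ^ n * (P.part (v, g v)).card := by gcongr
        _ = d ^ n * (η * (P.part (v, g v)).card) := by ring
        _ ≤ d ^ n * (X v).card := by gcongr
    · have h1 : (X v).card = Fintype.card G := by simp [X, if_neg hv]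
      have h2 : ((P.part (v, g v)).card : ℝ) ≤ n * Fintype.card G := by
        have := Finset.card_le_univ (P.part (v, g v))
        rw [hcardα] at this
        exact_mod_cast this
      rw [h1]
      calc n * (ρ * S) ≤ n * (ρ * (2 * (n * Fintype.card G))) := by
            gcongr
            linarith
        _ = 2 * n * n * ρ * Fintype.card G := by ring
        _ ≤ d ^ n * Fintype.card G := by gcongr
  have hmany := pow_le_card_of_isLowerRegular hd0 hd1 hs0 n X E hlower hbig
  have hle : ((Fintype.piFinset X).filter fun g => ∀ u v, u < v → E u v (g u) (g v)).card ≤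
      Nat.card {g : Fin n → G // ∀ u v, u < v → E u v (g u) (g v)} := by
    rw [Nat.card_eq_fintype_card, Fintype.card_subtype]
    exact Finset.card_le_card fun g hg =>
      Finset.mem_filter.2 ⟨Finset.mem_univ _, (Finset.mem_filter.1 hg).2⟩
  have hSN : (Fintype.card G : ℝ) / bound ρ l ≤ S := by
    rw [div_le_iff₀ hB0]
    have h1 : Fintype.card (Fin n × G) < P.parts.card * S := Nat.lt_mul_div_succ _ hparts
    have h2 : Fintype.card G ≤ Fintype.card (Fin n × G) := by
      rw [hcardα]
      exact Nat.le_mul_of_pos_left _ hn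
    have h3 : P.parts.card * S ≤ S * bound ρ l := by
      rw [mul_comm]
      exact Nat.mul_le_mul_left _ hPb
    exact_mod_cast (h2.trans h1.le).trans h3
  refine absurd hcount (not_lt.2 ?_)
  calc _ ≤ (ρ / bound ρ l) ^ n * (Fintype.card G : ℝ) ^ n := by
        gcongr
        exact min_le_right _ _
    _ = (ρ * ((Fintype.card G : ℝ) / bound ρ l)) ^ n := by rw [← mul_pow]; congr 1; ring
    _ ≤ (ρ * S) ^ n := by gcongr
    _ ≤ _ := hmany
    _ ≤ _ := by exact_mod_cast hle

/-! ### Removal for directed multigraphs -/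

/-- The removal lemma for homomorphisms from a directed multigraph on `n` vertices, where every
arc `i` carries its own relation `R i`; only `n` and `ε` determine `δ`. Loops are ignored.
Parallel and antiparallel arcs are handled by deleting from each of them the pairs deleted from
the intersection of their relations. -/
theorem ColoredDigraph.removal (n : ℕ) {ε : ℝ} (hε : 0 < ε) :
    ∃ δ : ℝ, 0 < δ ∧ ∀ (V : Type) [Finite V], Nat.card V = n → ∀ (m : ℕ)
      (H : ColoredDigraph V m) (G : Type*) [Finite G] (R : Fin m → G → G → Prop),
      (Nat.card {g : V → G // ∀ i, H.src i ≠ H.tgt i → R i (g (H.src i)) (g (H.tgt i))} : ℝ)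
        < δ * (Nat.card G : ℝ) ^ n →
      ∃ D : Fin m → Set (G × G), (∀ i, ((D i).ncard : ℝ) ≤ ε * (Nat.card G : ℝ) ^ 2) ∧
        ∀ g : V → G, (∀ i, H.src i ≠ H.tgt i → R i (g (H.src i)) (g (H.tgt i))) →
          ∃ i, H.src i ≠ H.tgt i ∧ (g (H.src i), g (H.tgt i)) ∈ D i := by
  classical
  obtain ⟨δ, hδ, h⟩ := partite_removal n hε
  refine ⟨δ, hδ, fun V _ hV m H G _ R hcount => ?_⟩
  let φ : V ≃ Fin n := Finite.equivFinOfCardEq hV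
  let J : Fin n → Fin n → Prop := fun u v =>
    ∃ i, (φ (H.src i) = u ∧ φ (H.tgt i) = v) ∨ (φ (H.src i) = v ∧ φ (H.tgt i) = u)
  let E : Fin n → Fin n → G → G → Prop := fun u v a b =>
    ∀ i, (φ (H.src i) = u ∧ φ (H.tgt i) = v → R i a b) ∧
      (φ (H.src i) = v ∧ φ (H.tgt i) = u → R i b a)
  have hJE : ∀ u v, u < v → ¬ J u v → ∀ a b, E u v a b := by
    intro u v _ hJ a b i
    exact ⟨fun hi => (hJ ⟨i, Or.inl hi⟩).elim, fun hi => (hJ ⟨i, Or.inr hi⟩).elim⟩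
  have hiff : ∀ g : V → G, (∀ i, H.src i ≠ H.tgt i → R i (g (H.src i)) (g (H.tgt i))) ↔
      ∀ u v, u < v → E u v (g (φ.symm u)) (g (φ.symm v)) := by
    intro g
    constructor
    · rintro hg u v huv i
      constructor
      · rintro ⟨rfl, rfl⟩
        simpa using hg i fun h => huv.ne (congrArg φ h)
      · rintro ⟨rfl, rfl⟩
        simpa using hg i fun h => huv.ne' (congrArg φ h)
    · intro hg i hi
      rcases lt_or_gt_of_ne (φ.injective.ne hi) with hlt | hlt
      · simpa using (hg _ _ hlt i).1 ⟨rfl, rfl⟩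
      · simpa using (hg _ _ hlt i).2 ⟨rfl, rfl⟩
  have hcard : Nat.card {g : Fin n → G // ∀ u v, u < v → E u v (g u) (g v)} =
      Nat.card {g : V → G // ∀ i, H.src i ≠ H.tgt i → R i (g (H.src i)) (g (H.tgt i))} :=
    (Nat.card_congr ((φ.arrowCongr (Equiv.refl G)).subtypeEquiv fun g => hiff g)).symm
  obtain ⟨D, hD, hcut⟩ := h G J E hJE (by rw [hcard]; exact hcount)
  refine ⟨fun i => if φ (H.src i) < φ (H.tgt i) then D (φ (H.src i)) (φ (H.tgt i))
    else Prod.swap ⁻¹' D (φ (H.tgt i)) (φ (H.src i)), fun i => ?_, fun g hg => ?_⟩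
  · dsimp only
    split_ifs
    · exact hD _ _
    · rw [← Set.image_swap_eq_preimage_swap, Set.ncard_image_of_injective _ Prod.swap_injective]
      exact hD _ _
  · obtain ⟨u, v, huv, ⟨i, ⟨rfl, rfl⟩ | ⟨rfl, rfl⟩⟩, hmem⟩ :=
      hcut (fun u => g (φ.symm u)) ((hiff g).1 hg)
    · refine ⟨i, fun h => huv.ne (congrArg φ h), ?_⟩
      simpa [huv] using hmem
    · refine ⟨i, fun h => huv.ne' (congrArg φ h), ?_⟩
      simpa [huv.not_gt] using hmem

/-! ### Labellings of the arcs -/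

namespace ColoredDigraph

variable {V : Type} {m : ℕ} {G : Type*} [Group G]

/-- The labelling of the arcs by the quotients of a potential `g` on the vertices. -/
def coboundary (H : ColoredDigraph V m) (g : V → G) (i : Fin m) : G :=
  (g (H.src i))⁻¹ * g (H.tgt i)

/-- The product of the labels along a list of traversals; an arc traversed backwards contributes the
inverse of its label. -/
def holonomy (x : Fin m → G) (l : List (Fin m × Bool)) : G :=
  (l.map fun s => if s.2 then x s.1 else (x s.1)⁻¹).prod

theorem coboundary_mul_left (H : ColoredDigraph V m) (g : V → G) (c : G) :
    H.coboundary (fun v => c * g v) = H.coboundary g := by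
  ext i
  simp [coboundary, mul_assoc]

theorem IsWalk.holonomy_coboundary {H : ColoredDigraph V m} (g : V → G)
    {l : List (Fin m × Bool)} {u v : V} (h : H.IsWalk u l v) :
    holonomy (H.coboundary g) l = (g u)⁻¹ * g v := by
  induction l generalizing u with
  | nil => obtain rfl : u = v := h; simp [holonomy]
  | cons s l ih =>
    obtain ⟨rfl, h⟩ := h
    have := ih h
    simp only [holonomy, List.map_cons, List.prod_cons] at this ⊢
    rw [this]
    rcases s with ⟨i, _ | _⟩ <;> simp [coboundary, start, finish, mul_assoc]

/-! ### Walks, paths and acyclic sets of arcs -/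

theorem IsWalk.append {H : ColoredDigraph V m} {l₁ l₂ : List (Fin m × Bool)} {u v w : V}
    (h₁ : H.IsWalk u l₁ v) (h₂ : H.IsWalk v l₂ w) : H.IsWalk u (l₁ ++ l₂) w := by
  induction l₁ generalizing u with
  | nil => obtain rfl : u = v := h₁; exact h₂
  | cons s l ih => exact ⟨h₁.1, ih h₁.2⟩

theorem IsWalk.exists_suffix {H : ColoredDigraph V m} {l : List (Fin m × Bool)} {u v w : V}
    (h : H.IsWalk u l v) (hw : w ∈ l.map H.start ++ [v]) :
    ∃ l', l' <:+ l ∧ H.IsWalk w l' v := by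
  induction l generalizing u with
  | nil =>
    obtain rfl : w = v := by simpa using hw
    exact ⟨[], List.suffix_refl _, rfl⟩
  | cons s l ih =>
    rw [List.map_cons, List.cons_append, List.mem_cons] at hw
    rcases hw with rfl | hw
    · exact ⟨s :: l, List.suffix_refl _, rfl, h.2⟩
    · obtain ⟨l', hl', hwalk⟩ := ih h.2 hw
      exact ⟨l', hl'.trans (List.suffix_cons _ _), hwalk⟩

theorem IsWalk.exists_path {H : ColoredDigraph V m} {S : Set (Fin m)}
    {l : List (Fin m × Bool)} {u v : V} (h : H.IsWalk u l v) (hS : ∀ s ∈ l, s.1 ∈ S) :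
    ∃ l', H.IsWalk u l' v ∧ (∀ s ∈ l', s.1 ∈ S) ∧ (l'.map H.start ++ [v]).Nodup := by
  induction l generalizing u with
  | nil => exact ⟨[], h, by simp, by simp⟩
  | cons s l ih =>
    obtain ⟨rfl, h⟩ := h
    obtain ⟨l', hl', hS', hnd⟩ := ih h fun t ht => hS t (List.mem_cons_of_mem _ ht)
    by_cases hmem : H.start s ∈ l'.map H.start ++ [v]
    · obtain ⟨l'', hsuf, hwalk⟩ := hl'.exists_suffix hmem
      exact ⟨l'', hwalk, fun t ht => hS' t (hsuf.subset ht),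
        hnd.sublist ((hsuf.sublist.map _).append_right _)⟩
    · refine ⟨s :: l', ⟨rfl, hl'⟩, ?_, ?_⟩
      · intro t ht
        rcases List.mem_cons.1 ht with rfl | ht
        · exact hS _ List.mem_cons_self
        · exact hS' t ht
      · rw [List.map_cons, List.cons_append, List.nodup_cons]
        exact ⟨hmem, hnd⟩

theorem IsWalk.finish_mem {H : ColoredDigraph V m} {l : List (Fin m × Bool)} {u v : V}
    (h : H.IsWalk u l v) {s : Fin m × Bool} (hs : s ∈ l) :
    H.finish s ∈ l.map H.start ++ [v] := by
  induction l generalizing u with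
  | nil => simp at hs
  | cons t l ih =>
    rw [List.map_cons, List.cons_append]
    apply List.mem_cons_of_mem
    rcases List.mem_cons.1 hs with rfl | hs
    · cases l with
      | nil =>
        have hv : H.finish s = v := h.2
        simp [hv]
      | cons r l => simp [h.2.1]
    · exact ih h.2 hs

/-- A walk that repeats no vertex repeats no arc. -/
theorem IsWalk.nodup_arcs {H : ColoredDigraph V m} {l : List (Fin m × Bool)} {u v : V}
    (h : H.IsWalk u l v) (hnd : (l.map H.start ++ [v]).Nodup) : (l.map Prod.fst).Nodup := by
  induction l generalizing u with
  | nil => simp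
  | cons s l ih =>
    rw [List.map_cons, List.cons_append, List.nodup_cons] at hnd
    rw [List.map_cons, List.nodup_cons]
    refine ⟨fun hmem => hnd.1 ?_, ih h.2 hnd.2⟩
    obtain ⟨t, ht, hts⟩ := List.mem_map.1 hmem
    have h1 : H.start t ∈ l.map H.start ++ [v] :=
      List.mem_append_left _ (List.mem_map_of_mem ht)
    have h2 := h.2.finish_mem ht
    rcases s with ⟨i, b⟩
    rcases t with ⟨j, c⟩
    obtain rfl : j = i := hts
    cases b <;> cases c <;> first | exact h1 | exact h2

/-- In an acyclic set of arcs, the ends of an arc are not connected by other arcs of the set. -/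
theorem not_isWalk_of_acyclic {H : ColoredDigraph V m} {T S : Set (Fin m)} {t : Fin m}
    (hT : ¬ ∃ l, H.IsCycle l ∧ ∀ s ∈ l, s.1 ∈ T) (htT : t ∈ T) (hS : S ⊆ T) (htS : t ∉ S)
    {l : List (Fin m × Bool)} (hl : ∀ s ∈ l, s.1 ∈ S) : ¬ H.IsWalk (H.tgt t) l (H.src t) := by
  intro hwalk
  obtain ⟨l', hl', hS', hnd⟩ := hwalk.exists_path hl
  refine hT ⟨(t, true) :: l', ⟨by simp, ⟨H.src t, rfl, hl'⟩, ?_, ?_⟩, ?_⟩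
  · rw [List.map_cons, List.nodup_cons]
    refine ⟨fun hmem => htS ?_, hl'.nodup_arcs hnd⟩
    obtain ⟨s, hs, rfl⟩ := List.mem_map.1 hmem
    exact hS' s hs
  · rw [List.map_cons]
    exact (List.perm_append_singleton _ _).nodup_iff.1 hnd
  · intro s hs
    rcases List.mem_cons.1 hs with rfl | hs
    · exact htT
    · exact hS (hS' s hs)

/-! ### Potentials on a spanning tree -/

/-- Any labelling of an acyclic set of arcs comes from a potential. When an arc is added, the
potential is translated on the component of its terminal vertex. -/
theorem exists_coboundary_eq {H : ColoredDigraph V m} {T : Set (Fin m)}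
    (hT : ¬ ∃ l, H.IsCycle l ∧ ∀ s ∈ l, s.1 ∈ T) (x : Fin m → G) :
    ∃ g : V → G, ∀ i ∈ T, H.coboundary g i = x i := by
  classical
  suffices h : ∀ S : Set (Fin m), S.Finite → S ⊆ T →
      ∃ g : V → G, ∀ i ∈ S, H.coboundary g i = x i from h T T.toFinite subset_rfl
  intro S hS
  induction S, hS using Set.Finite.induction_on with
  | empty => exact fun _ => ⟨fun _ => 1, by simp⟩
  | @insert t S htS _ ih =>
    intro hsub
    obtain ⟨g, hg⟩ := ih ((Set.subset_insert _ _).trans hsub)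
    let C : Set V := {w | ∃ l, (∀ s ∈ l, s.1 ∈ S) ∧ H.IsWalk (H.tgt t) l w}
    have htgt : H.tgt t ∈ C := ⟨[], by simp, rfl⟩
    have hsrc : H.src t ∉ C := fun ⟨l, hl, hwalk⟩ =>
      not_isWalk_of_acyclic hT (hsub (Set.mem_insert _ _))
        ((Set.subset_insert _ _).trans hsub) htS hl hwalk
    have hstep : ∀ s : Fin m × Bool, s.1 ∈ S → H.start s ∈ C → H.finish s ∈ C := by
      rintro s hs ⟨l, hl, hwalk⟩
      refine ⟨l ++ [s], ?_, hwalk.append ⟨rfl, rfl⟩⟩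
      intro r hr
      rcases List.mem_append.1 hr with hr | hr
      · exact hl r hr
      · rw [List.mem_singleton.1 hr]
        exact hs
    have hC : ∀ i ∈ S, H.src i ∈ C ↔ H.tgt i ∈ C := fun i hi =>
      ⟨hstep (i, true) hi, hstep (i, false) hi⟩
    let c : G := g (H.src t) * x t * (g (H.tgt t))⁻¹
    refine ⟨fun w => if w ∈ C then c * g w else g w, ?_⟩
    rintro i (rfl | hi)
    · simp [coboundary, htgt, hsrc, c, mul_assoc]
    · rw [← hg i hi]
      by_cases h : H.src i ∈ C
      · simp [coboundary, h, (hC i hi).1 h, mul_assoc]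
      · simp [coboundary, h, mt (hC i hi).2 h]

theorem holonomy_congr {x y : Fin m → G} {l : List (Fin m × Bool)}
    (h : ∀ s ∈ l, x s.1 = y s.1) : holonomy x l = holonomy y l := by
  unfold holonomy
  congr 1
  exact List.map_congr_left fun s hs => by rw [h s hs]

/-- A potential on a connected graph is determined by its value at one vertex and the labels of the
arcs of a spanning tree, and these may be prescribed. -/
theorem IsSpanningTree.bijective {H : ColoredDigraph V m} {T : Set (Fin m)}
    (hT : H.IsSpanningTree T) (r : V) :
    Function.Bijective fun g : V → G => ((g r, fun i => H.coboundary g i) : G × (T → G)) := by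
  constructor
  · intro g g' h
    simp only [Prod.mk.injEq] at h
    ext v
    obtain ⟨l, hl, hlT⟩ := hT.2.1 r v
    have h1 := hl.holonomy_coboundary g
    have h2 := hl.holonomy_coboundary g'
    rw [holonomy_congr fun s hs => congrFun h.2 ⟨s.1, hlT s hs⟩, h2, h.1] at h1
    exact (mul_left_cancel h1).symm
  · classical
    rintro ⟨c, y⟩
    obtain ⟨g, hg⟩ := exists_coboundary_eq (G := G) hT.2.2
      fun i => if h : i ∈ T then y ⟨i, h⟩ else 1
    refine ⟨fun v => c * (g r)⁻¹ * g v, ?_⟩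
    simp only [coboundary_mul_left, Prod.mk.injEq]
    refine ⟨by simp, funext fun i => ?_⟩
    rw [hg i i.2, dif_pos i.2]

theorem IsSpanningTree.card_eq [Finite V] {H : ColoredDigraph V m} {T : Set (Fin m)}
    (hT : H.IsSpanningTree T) : Nat.card V = Nat.card T + 1 := by
  obtain ⟨r⟩ := hT.1
  -- compare the numbers of potentials and of labellings with values in a group of order two
  have h := Nat.card_eq_of_bijective _ (hT.bijective (G := Multiplicative (ZMod 2)) r)
  have h2 : Nat.card (Multiplicative (ZMod 2)) = 2 := by simp
  rw [Nat.card_prod, Nat.card_fun, Nat.card_fun, h2, ← pow_succ'] at h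
  exact Nat.pow_right_injective le_rfl h

theorem holonomy_append (x : Fin m → G) (l₁ l₂ : List (Fin m × Bool)) :
    holonomy x (l₁ ++ l₂) = holonomy x l₁ * holonomy x l₂ := by
  simp [holonomy]

theorem IsCycle.holonomy_coboundary {H : ColoredDigraph V m} {l : List (Fin m × Bool)}
    (hl : H.IsCycle l) (g : V → G) : holonomy (H.coboundary g) l = 1 := by
  obtain ⟨u, hu⟩ := hl.2.1
  rw [hu.holonomy_coboundary g, inv_mul_cancel]

/-- The equation of the fundamental cycle of an arc determines the label of this arc. -/
theorem IsFundamentalCycle.coboundary_eq {H : ColoredDigraph V m} {T : Set (Fin m)} {e : Fin m}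
    {l : List (Fin m × Bool)} (hl : H.IsFundamentalCycle T e l) {x : Fin m → G} {g : V → G}
    (hg : ∀ i ∈ T, H.coboundary g i = x i) (hx : holonomy x l = 1) :
    H.coboundary g e = x e := by
  obtain ⟨hcyc, heT, hel, hmem⟩ := hl
  obtain ⟨s, hs, rfl⟩ := List.mem_map.1 hel
  obtain ⟨l₁, l₂, rfl⟩ := List.append_of_mem hs
  have hnd := hcyc.2.2.1
  rw [List.map_append, List.map_cons, List.nodup_middle, List.nodup_cons] at hnd
  have hne : ∀ t, t ∈ l₁ ∨ t ∈ l₂ → H.coboundary g t.1 = x t.1 := by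
    intro t ht
    have ht' : t.1 ≠ s.1 := by
      intro h
      apply hnd.1
      rw [← h, ← List.map_append]
      exact List.mem_map_of_mem (List.mem_append.2 ht)
    refine hg _ ((hmem t ?_).resolve_left ht')
    rcases ht with ht | ht <;> simp [ht]
  have h := (hcyc.holonomy_coboundary g).trans hx.symm
  rw [← List.singleton_append, holonomy_append, holonomy_append, holonomy_append,
    holonomy_append, holonomy_congr fun t ht => hne t (Or.inl ht),
    holonomy_congr (l := l₂) fun t ht => hne t (Or.inr ht)] at h
  have h' := mul_right_cancel (mul_left_cancel h)
  rcases s with ⟨i, _ | _⟩ <;> simpa [holonomy] using h'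

end ColoredDigraph

namespace WordSystem

variable {k m : ℕ} {G : Type*} [Group G]

/-- The left-hand side of an equation is the product of the variables along its traversals. -/
theorem prod_eq_holonomy (S : WordSystem k m) (x : Fin m → G) (i : Fin k) :
    (List.ofFn fun j => x (S.perm i j) ^ (S.exponent i (S.perm i j) : ℤ)).prod =
      ColoredDigraph.holonomy x (S.traversals i) := by
  have h : (List.ofFn fun j => x (S.perm i j) ^ (S.exponent i (S.perm i j) : ℤ)) =
      (List.ofFn (S.perm i)).map fun v => x v ^ (S.exponent i v : ℤ) := by
    rw [List.map_ofFn]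
    rfl
  rw [h, traversals]
  induction List.ofFn (S.perm i) with
  | nil => rfl
  | cons v l ih =>
    rw [List.map_cons, List.prod_cons, ih, List.filterMap_cons]
    rcases hv : S.exponent i v <;> simp [traversal, ColoredDigraph.holonomy]

theorem isSolution_iff (S : WordSystem k m) (x : Fin m → G) :
    S.IsSolution x ↔ ∀ i, ColoredDigraph.holonomy x (S.traversals i) = 1 :=
  forall_congr' fun i => by rw [prod_eq_holonomy]

/-- The solutions of a representable system are the labellings that come from potentials. -/
theorem isSolution_iff_exists_coboundary {V : Type} {H : ColoredDigraph V m} {T : Set (Fin m)}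
    (hT : H.IsSpanningTree T) {S : WordSystem k m} (e : Fin k ≃ {a : Fin m // a ∉ T})
    (he : ∀ i, H.IsFundamentalCycle T (e i) (S.traversals i)) (x : Fin m → G) :
    S.IsSolution x ↔ ∃ g : V → G, H.coboundary g = x := by
  rw [isSolution_iff]
  constructor
  · intro hx
    obtain ⟨g, hg⟩ := ColoredDigraph.exists_coboundary_eq hT.2.2 x
    refine ⟨g, funext fun i => ?_⟩
    by_cases hi : i ∈ T
    · exact hg i hi
    · have h := (he (e.symm ⟨i, hi⟩)).coboundary_eq hg (hx _)
      simpa using h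
  · rintro ⟨g, rfl⟩ i
    exact (he i).1.holonomy_coboundary g

end WordSystem

/-! ### Removal for systems of equations in groups -/

open scoped Classical in
/-- Counting pairs `(c, c * a)` in `D` by the quotient `a` of their entries. -/
theorem card_mul_card_le_of_forall_le {G : Type*} [Group G] [Finite G] (m N : ℕ) (D : Set (G × G))
    (B : Set G) (h : ∀ a ∈ B, N ≤ m * {c : G | (c, c * a) ∈ D}.ncard) :
    B.ncard * N ≤ m * D.ncard := by
  have := Fintype.ofFinite G
  have h1 : ∀ a, {c : G | (c, c * a) ∈ D}.ncard =
      (Finset.univ.filter fun c : G => (c, c * a) ∈ D).card := fun a => by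
    rw [← Set.ncard_coe_finset]
    simp
  have h2 : (B.toFinset.sigma fun a => Finset.univ.filter fun c : G => (c, c * a) ∈ D).card ≤
      D.toFinset.card := by
    apply Finset.card_le_card_of_injOn fun p : (_ : G) × G => (p.2, p.2 * p.1)
    · rintro ⟨a, c⟩ hp
      simpa using (Finset.mem_filter.1 (Finset.mem_sigma.1 (Finset.mem_coe.1 hp)).2).2
    · rintro ⟨a, c⟩ _ ⟨a', c'⟩ _ heq
      simp only [Prod.mk.injEq] at heq
      obtain ⟨rfl, heq⟩ := heq
      obtain rfl := mul_left_cancel heq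
      rfl
  rw [Set.ncard_eq_toFinset_card' B, Set.ncard_eq_toFinset_card' D]
  calc B.toFinset.card * N = ∑ _a ∈ B.toFinset, N := by simp
    _ ≤ ∑ a ∈ B.toFinset, m * (Finset.univ.filter fun c : G => (c, c * a) ∈ D).card :=
        Finset.sum_le_sum fun a ha => by
          rw [← h1]
          exact h a (Set.mem_toFinset.1 ha)
    _ ≤ m * D.toFinset.card := by
        rw [← Finset.mul_sum, ← Finset.card_sigma]
        exact Nat.mul_le_mul_left _ h2

/-- If the quotient labelling of a potential `g` takes values that rarely occur in the sets `D i`,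
then some translate of `g` avoids all `D i`. -/
theorem ColoredDigraph.exists_translate_notMem {V : Type} {m : ℕ} (hm : 0 < m) {G : Type*}
    [Group G] [Finite G] (H : ColoredDigraph V m) (D : Fin m → Set (G × G)) (g : V → G)
    (h : ∀ i, m * {c : G | (c, c * H.coboundary g i) ∈ D i}.ncard < Nat.card G) :
    ∃ c : G, ∀ i, (c * g (H.src i), c * g (H.tgt i)) ∉ D i := by
  classical
  have := Fintype.ofFinite G
  by_contra! hcon
  have hcard : ∀ i, (Finset.univ.filter fun c : G =>
      (c * g (H.src i), c * g (H.tgt i)) ∈ D i).card =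
      {c : G | (c, c * H.coboundary g i) ∈ D i}.ncard := by
    intro i
    rw [← Set.ncard_coe_finset]
    have : {c : G | (c, c * H.coboundary g i) ∈ D i} =
        (fun c => c * g (H.src i)) '' ((Finset.univ.filter fun c : G =>
          (c * g (H.src i), c * g (H.tgt i)) ∈ D i : Finset G) : Set G) := by
      ext c
      simp only [Finset.coe_filter, Finset.mem_univ, true_and, Set.mem_image, Set.mem_ofPred_eq]
      constructor
      · intro hc
        refine ⟨c * (g (H.src i))⁻¹, ?_, by simp⟩
        simpa [ColoredDigraph.coboundary, mul_assoc] using hc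
      · rintro ⟨c, hc, rfl⟩
        simpa [ColoredDigraph.coboundary, mul_assoc] using hc
    rw [this, Set.ncard_image_of_injective _ (mul_left_injective _)]
  have hcover : Fintype.card G ≤ ∑ i, (Finset.univ.filter fun c : G =>
      (c * g (H.src i), c * g (H.tgt i)) ∈ D i).card := by
    refine le_trans ?_ Finset.card_biUnion_le
    rw [← Finset.card_univ]
    refine Finset.card_le_card fun c _ => ?_
    obtain ⟨i, hi⟩ := hcon c
    exact Finset.mem_biUnion.2 ⟨i, Finset.mem_univ _, by simpa using hi⟩
  have hlt : m * Fintype.card G < m * Fintype.card G := by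
    calc m * Fintype.card G ≤ m * ∑ i, (Finset.univ.filter fun c : G =>
          (c * g (H.src i), c * g (H.tgt i)) ∈ D i).card := Nat.mul_le_mul_left _ hcover
      _ = ∑ i, m * {c : G | (c, c * H.coboundary g i) ∈ D i}.ncard := by
          rw [Finset.mul_sum]
          exact Finset.sum_congr rfl fun i _ => by rw [hcard]
      _ < ∑ _i : Fin m, Fintype.card G :=
          Finset.sum_lt_sum_of_nonempty ⟨⟨0, hm⟩, Finset.mem_univ _⟩ fun i _ => by
            rw [← Nat.card_eq_fintype_card]
            exact h i
      _ = m * Fintype.card G := by simp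
  exact lt_irrefl _ hlt

namespace WordSystem

/-- The removal property with parameters `ε` and `δ`, for all representable systems in `m`
variables over all finite groups. -/
def RemovalProperty.{u} (m : ℕ) (ε δ : ℝ) : Prop :=
  ∀ k : ℕ, 1 ≤ k → ∀ S : WordSystem k m, S.StronglyGraphRepresentable →
    ∀ (G : Type u) [Group G] [Finite G] (A : Fin m → Set G),
      ((S.solutions A).ncard : ℝ) < δ * (Nat.card G : ℝ) ^ (m - k) →
        ∃ A' : Fin m → Set G,
          (∀ i, A' i ⊆ A i ∧ ((A i \ A' i).ncard : ℝ) ≤ ε * (Nat.card G : ℝ)) ∧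
          S.solutions A' = ∅

/-- The removal property for any given `ε > 0` and some `δ > 0`. -/
theorem exists_removalProperty.{u} {m : ℕ} (hm : 0 < m) {ε : ℝ} (hε : 0 < ε) :
    ∃ δ : ℝ, 0 < δ ∧ RemovalProperty.{u} m ε δ := by
  classical
  have hm' : (0 : ℝ) < m := by exact_mod_cast hm
  choose f hf0 hf using fun n : ℕ => ColoredDigraph.removal.{u} n (div_pos hε hm')
  refine ⟨(Finset.range (m + 1)).inf' ⟨0, by simp⟩ f,
    (Finset.lt_inf'_iff _).2 fun n _ => hf0 n, ?_⟩
  rintro k hk S ⟨V, _, H, T, hT, e, he⟩ G _ _ A hcount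
  obtain ⟨r⟩ := hT.1
  have hcardV := hT.card_eq
  have hcardT : Nat.card T + k = m := by
    have h1 := Nat.card_congr (Equiv.Set.sumCompl T)
    have h2 : Nat.card (Tᶜ : Set (Fin m)) = k := by
      rw [← Nat.card_fin k]
      exact (Nat.card_congr e).symm
    rwa [Nat.card_sum, h2, Nat.card_fin] at h1
  have hsol := isSolution_iff_exists_coboundary (G := G) hT e he
  have hN : (0 : ℝ) < Nat.card G := by exact_mod_cast Nat.card_pos
  -- a loop forces its variable to be `1`
  by_cases hloop : ∃ i, H.src i = H.tgt i ∧ 1 ∉ A i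
  · obtain ⟨i, hi, h1⟩ := hloop
    refine ⟨A, fun i => ⟨subset_rfl, by simpa using by positivity⟩, ?_⟩
    rw [Set.eq_empty_iff_forall_notMem]
    rintro x ⟨hxA, hx⟩
    obtain ⟨g, rfl⟩ := (hsol x).1 hx
    have := hxA i
    rw [ColoredDigraph.coboundary, hi, inv_mul_cancel] at this
    exact h1 this
  push Not at hloop
  let Hom : Set (V → G) :=
    {g | ∀ i, H.src i ≠ H.tgt i → (g (H.src i))⁻¹ * g (H.tgt i) ∈ A i}
  have hHom : ∀ g ∈ Hom, H.coboundary g ∈ S.solutions A := by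
    refine fun g hg => ⟨fun i => ?_, (hsol _).2 ⟨g, rfl⟩⟩
    by_cases hi : H.src i = H.tgt i
    · simpa [ColoredDigraph.coboundary, hi] using hloop i hi
    · exact hg i hi
  have hHomcard : Nat.card Hom ≤ Nat.card G * (S.solutions A).ncard := by
    rw [← Nat.card_coe_set_eq (S.solutions A), ← Nat.card_prod]
    refine Nat.card_le_card_of_injective
      (fun g : Hom => ((g.1 r, ⟨H.coboundary g.1, hHom _ g.2⟩) : G × S.solutions A)) ?_
    rintro ⟨g, hg⟩ ⟨g', hg'⟩ h
    simp only [Prod.mk.injEq, Subtype.mk.injEq] at h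
    refine Subtype.ext ((hT.bijective r).1 ?_)
    simp only [Prod.mk.injEq]
    exact ⟨h.1, funext fun i => congrFun h.2 i⟩
  obtain ⟨D, hD, hcut⟩ := hf (Nat.card V) V rfl m H G (fun i a b => a⁻¹ * b ∈ A i) <| by
    calc (Nat.card Hom : ℝ) ≤ Nat.card G * (S.solutions A).ncard := by exact_mod_cast hHomcard
      _ < Nat.card G * (_ * (Nat.card G : ℝ) ^ (m - k)) := by gcongr
      _ = (Finset.range (m + 1)).inf' ⟨0, by simp⟩ f * (Nat.card G : ℝ) ^ Nat.card V := by
          rw [hcardV, show m - k = Nat.card T by omega]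
          ring
      _ ≤ f (Nat.card V) * (Nat.card G : ℝ) ^ Nat.card V := by
          gcongr
          exact Finset.inf'_le _ (Finset.mem_range.2 (by omega))
  -- keep the elements that are the quotient of few deleted pairs
  refine ⟨fun i => {a ∈ A i | m * {c : G | (c, c * a) ∈ D i}.ncard < Nat.card G},
    fun i => ⟨Set.sep_subset _ _, ?_⟩, ?_⟩
  · have h := card_mul_card_le_of_forall_le m (Nat.card G) (D i)
      (A i \ {a ∈ A i | m * {c : G | (c, c * a) ∈ D i}.ncard < Nat.card G})
      fun a ha => not_lt.1 fun hlt => ha.2 ⟨ha.1, hlt⟩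
    refine le_of_mul_le_mul_right ?_ hN
    calc _ ≤ (m : ℝ) * (D i).ncard := by exact_mod_cast h
      _ ≤ m * (ε / m * (Nat.card G : ℝ) ^ 2) := by gcongr; exact hD i
      _ = ε * Nat.card G * Nat.card G := by field_simp
  · rw [Set.eq_empty_iff_forall_notMem]
    rintro x ⟨hxA, hx⟩
    obtain ⟨g, rfl⟩ := (hsol x).1 hx
    obtain ⟨c, hc⟩ := H.exists_translate_notMem hm D g fun i => (hxA i).2
    obtain ⟨i, -, hi⟩ := hcut (fun v => c * g v) fun i _ => by
      simpa [ColoredDigraph.coboundary, mul_assoc] using (hxA i).1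
    exact hc i hi

theorem RemovalProperty.mono.{u} {m : ℕ} {ε ε' δ δ' : ℝ} (h : RemovalProperty.{u} m ε δ)
    (hε : ε ≤ ε') (hδ : δ' ≤ δ) : RemovalProperty.{u} m ε' δ' := by
  intro k hk S hS G _ _ A hcount
  obtain ⟨A', hA', hempty⟩ := h k hk S hS G A (hcount.trans_le (by gcongr))
  exact ⟨A', fun i => ⟨(hA' i).1, (hA' i).2.trans (by gcongr)⟩, hempty⟩

theorem removalProperty_one.{u} {m : ℕ} (hm : 0 < m) (δ : ℝ) : RemovalProperty.{u} m 1 δ := by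
  intro k _ S _ G _ _ A _
  refine ⟨fun _ => ∅, fun i => ⟨Set.empty_subset _, ?_⟩, ?_⟩
  · rw [one_mul]
    exact_mod_cast Set.ncard_le_card _
  · exact Set.eq_empty_iff_forall_notMem.2 fun x hx => hx.1 ⟨0, hm⟩

end WordSystem

theorem theorem4 (m : ℕ) (hm : 2 ≤ m) :
    ∃ δ' : ℝ → ℝ, Tendsto δ' (𝓝[>] 0) (𝓝 0) ∧
      ∀ (k : ℕ), 1 ≤ k → ∀ S : WordSystem k m, S.StronglyGraphRepresentable →
        ∀ (G : Type*) [Group G] [Finite G] (A : Fin m → Set G) (δ : ℝ), 0 < δ →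
          ((S.solutions A).ncard : ℝ) < δ * (Nat.card G : ℝ) ^ (m - k) →
            ∃ A' : Fin m → Set G,
              (∀ i, A' i ⊆ A i ∧ ((A i \ A' i).ncard : ℝ) ≤ δ' δ * (Nat.card G : ℝ)) ∧
              S.solutions A' = ∅ := by
  have hm0 : 0 < m := by omega
  let P : ℝ → Set ℝ := fun δ => {ε | 0 < ε ∧ WordSystem.RemovalProperty m ε δ}
  have hbdd : ∀ δ, BddBelow (P δ) := fun δ => ⟨0, fun ε hε => hε.1.le⟩
  have hne : ∀ δ, (P δ).Nonempty := fun δ => ⟨1, one_pos, WordSystem.removalProperty_one hm0 δ⟩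
  -- The infimum of the admissible `ε` need not be attained, hence the additional summand `δ`.
  refine ⟨fun δ => sInf (P δ) + δ, ?_, ?_⟩
  · rw [Metric.tendsto_nhdsWithin_nhds]
    intro ε hε
    obtain ⟨δ₀, hδ₀, h⟩ := WordSystem.exists_removalProperty hm0 (half_pos hε)
    refine ⟨min δ₀ (ε / 2), by positivity, fun δ hδ hdist => ?_⟩
    have hδ0 : 0 < δ := hδ
    rw [Real.dist_eq, sub_zero, abs_of_pos hδ0, lt_min_iff] at hdist
    have h1 : sInf (P δ) ≤ ε / 2 :=
      csInf_le (hbdd δ) ⟨half_pos hε, h.mono le_rfl hdist.1.le⟩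
    have h2 : 0 ≤ sInf (P δ) := Real.sInf_nonneg fun x hx => hx.1.le
    rw [Real.dist_eq, sub_zero, abs_of_nonneg (by linarith)]
    linarith
  · intro k hk S hS G _ _ A δ hδ hcount
    obtain ⟨ε, hε, hlt⟩ := exists_lt_of_csInf_lt (hne δ) (lt_add_of_pos_right (sInf (P δ)) hδ)
    exact hε.2.mono hlt.le le_rfl k hk S hS G A hcount
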